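/- Let $g:\mathbb{R}^n\to\mathbb{R}$ be differentiable and $\tilde x\in\mathbb{R}^n$; write $g=g(\tilde x)$ and $\nabla g=\nabla g(\tilde x)$. Let $0<\epsilon<1/2$ and $\kappa=-\Phi^{-1}(\epsilon)>0$, where $\Phi$ is the distribution function of the standard normal distribution. Let $\tilde\mu\in\mathbb{R}^n$, let $\tilde\Sigma\in\mathcal{S}^n$ be a positive definite matrix, let $A\in\mathbb{R}^{n\times m}$, $B\in\mathbb{R}^{n\times k}$ and $\alpha,\beta\ge 0$, and put $$U_\mu=\{\tilde\mu+Az_1 : z_1\in\mathbb{R}^m,\ \|z_1\|_\infty\le\alpha\},\qquad U_\Sigma=\{\tilde\Sigma+BZ_2B^\top : Z_2\in\mathcal{S}^k,\ \|Z_2\|_{\infty,\infty}\le\beta\}\cap\mathcal{S}_+^n .$$ Here $\mathcal{S}^n$ and $\mathcal{S}_+^n$ are the sets of symmetric, respectively symmetric positive semidefinite, real $n\times n$ matrices, $\|Z\|_{\infty,\infty}=\max_{i,j}|Z_{ij}|$, $\|Z\|_{1,1}=\sum_{i,j}|Z_{ij}|$, and $X\bullet Y=\operatorname{tr}(X^\top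 Y)$. Then $$\mathrm{P}_{\zeta\sim\mathsf{N}(\mu,\Sigma)}\{g+\nabla g^\top\zeta\le 0\}\ge 1-\epsilon\quad\text{for all }\mu\in U_\mu\text{ and }\Sigma\in U_\Sigma$$ (where $\mathsf{N}(\mu,\Sigma)$ is the possibly degenerate normal distribution with mean $\mu$ and covariance matrix $\Sigma$) if and only if there exist $z\in\mathbb{R}$ and $W\in\mathcal{S}^n$ such that $$g+\nabla g^\top\tilde\mu+\alpha\|A^\top\nabla g\|_1+\tilde\Sigma\bullet W+\beta\|B^\top WB\|_{1,1}+\kappa^2z\le 0$$ and $$\begin{bmatrix}W&\nabla g/2\\ \nabla g^\top/2&z\end{bmatrix}\succeq 0 .$$ -/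

import Mathlib

open MeasureTheory ProbabilityTheory Matrix
open scoped RealInnerProductSpace

namespace RobustReliability

noncomputable section

/-- The distribution function `Φ` of the standard normal distribution `N(0,1)`. -/
def stdNormalCDF (t : ℝ) : ℝ := cdf (gaussianReal 0 1) t

/-- The inverse `Φ⁻¹` of the standard normal distribution function (used on `(0,1)` only, the
range of the injective function `Φ`). -/
def stdNormalQuantile (p : ℝ) : ℝ := Function.invFun stdNormalCDF p

/-- `κ = -Φ⁻¹(ε)`. -/
def kappa (ε : ℝ) : ℝ := -stdNormalQuantile ε

/-- The matrix inner product `X • Y = tr (Xᵀ Y) = ∑ᵢⱼ Xᵢⱼ Yᵢⱼ`. -/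
def frobInner {m n : ℕ} (X Y : Matrix (Fin m) (Fin n) ℝ) : ℝ := (Xᵀ * Y).trace

/-- The `ℓ₁` norm of a vector. -/
def norm1 {n : ℕ} (x : Fin n → ℝ) : ℝ := ∑ i, |x i|

/-- The `ℓ_∞` norm of a vector (`0` for the empty vector). -/
def normInf {n : ℕ} (x : Fin n → ℝ) : ℝ := ⨆ i, |x i|

/-- The entrywise norm `‖X‖_{1,1}`, the sum of the absolute values of the entries. -/
def norm11 {m n : ℕ} (X : Matrix (Fin m) (Fin n) ℝ) : ℝ := ∑ i, ∑ j, |X i j|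

/-- The entrywise norm `‖X‖_{∞,∞}`, the largest absolute value of an entry (`0` for an empty
matrix). -/
def normInfInf {m n : ℕ} (X : Matrix (Fin m) (Fin n) ℝ) : ℝ :=
  ⨆ p : Fin m × Fin n, |X p.1 p.2|

/-- The uncertainty set `{μ₀ + A z₁ : ‖z₁‖_∞ ≤ α}` of the expected value vector. -/
def meanSet {n m : ℕ} (μ₀ : EuclideanSpace ℝ (Fin n)) (A : Matrix (Fin n) (Fin m) ℝ) (α : ℝ) :
    Set (EuclideanSpace ℝ (Fin n)) :=
  {μ | ∃ z₁ : Fin m → ℝ, normInf z₁ ≤ α ∧ μ = μ₀ + WithLp.toLp 2 (A *ᵥ z₁)}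

/-- The uncertainty set `{Σ₀ + B Z₂ Bᵀ : Z₂ symmetric, ‖Z₂‖_{∞,∞} ≤ β} ∩ S₊ⁿ` of the
variance-covariance matrix. -/
def covSet {n k : ℕ} (S₀ : Matrix (Fin n) (Fin n) ℝ) (B : Matrix (Fin n) (Fin k) ℝ) (β : ℝ) :
    Set (Matrix (Fin n) (Fin n) ℝ) :=
  {S | ∃ Z₂ : Matrix (Fin k) (Fin k) ℝ, Z₂.IsSymm ∧ normInfInf Z₂ ≤ β ∧ S = S₀ + B * Z₂ * Bᵀ} ∩
    {S | S.PosSemidef}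

/-- The linearized Gaussian reliability constraint
`P_{ζ ∼ N(μ,S)} {g(x) + ∇g(x)ᵀ ζ ≤ 0} ≥ 1 - ε`. -/
def LinReliable {n : ℕ} (g : EuclideanSpace ℝ (Fin n) → ℝ) (x : EuclideanSpace ℝ (Fin n)) (ε : ℝ)
    (μ : EuclideanSpace ℝ (Fin n)) (S : Matrix (Fin n) (Fin n) ℝ) : Prop :=
  1 - ε ≤ (multivariateGaussian μ S).real {ζ | g x + ⟪gradient g x, ζ⟫ ≤ 0}

/-- The symmetric block matrix `[[W, v/2], [vᵀ/2, z]]`. -/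
def borderedMatrix {n : ℕ} (W : Matrix (Fin n) (Fin n) ℝ) (v : Fin n → ℝ) (z : ℝ) :
    Matrix (Fin n ⊕ Unit) (Fin n ⊕ Unit) ℝ :=
  fromBlocks W (replicateCol Unit fun i => v i / 2) (replicateRow Unit fun i => v i / 2)
    (of fun _ _ => z)

end

end RobustReliability

open RobustReliability

open RobustReliability

namespace RobustReliability

/-! Write `v` for the gradient. Under `N(μ, S)` the variable `⟪v, ζ⟫` is normal with variance
`vᵀSv`, so the chance constraint reads `g + ⟪v, μ⟫ + κ√(vᵀSv) ≤ 0` (`linReliable_iff`). The mean and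
the covariance then separate. The worst mean contributes `α‖Aᵀv‖₁`, by duality of the `ℓ_∞` and `ℓ₁`
norms.

For the covariance, a feasible `(z, W)` bounds `κ√(vᵀSv)` through a Gram factorization of `S`
(`kappa_mul_sqrt_le`). Conversely, maximizing `vᵀSv` over the uncertainty set is a conic program
with Slater point `S₀ ≻ 0`. Separation gives a multiplier `Y ⪰ 0` for the constraint `S ⪰ 0`
(`exists_dual_certificate`), and a suitable multiple of `Y + vvᵀ` serves as `W`. -/

/-! ### The Gaussian chance constraint. -/

lemma stdNormalCDF_eq (t : ℝ) : stdNormalCDF t = (gaussianReal 0 1).real (Set.Iic t) :=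
  cdf_eq_real _ _

lemma strictMono_stdNormalCDF : StrictMono stdNormalCDF := by
  intro a b hab
  have hd : Set.Iic b = Set.Iic a ∪ Set.Ioc a b := (Set.Iic_union_Ioc_eq_Iic hab.le).symm
  have hpos : 0 < (gaussianReal 0 1).real (Set.Ioc a b) := by
    refine ENNReal.toReal_pos (fun h => ?_) (measure_ne_top _ _)
    have := gaussianReal_absolutelyContinuous' 0 (one_ne_zero) h
    simp at this
    linarith
  rw [stdNormalCDF_eq, stdNormalCDF_eq, hd,
    measureReal_union (Set.Iic_disjoint_Ioc le_rfl) measurableSet_Ioc]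
  linarith

lemma stdNormalCDF_neg (t : ℝ) : stdNormalCDF (-t) = 1 - stdNormalCDF t := by
  have := nullSingletonClass_gaussianReal (μ := 0) (v := 1) one_ne_zero
  rw [stdNormalCDF_eq, stdNormalCDF_eq, ← probReal_compl_eq_one_sub measurableSet_Iic,
    Set.compl_Iic, measureReal_congr (Ioi_ae_eq_Ici (a := t)), measureReal_def, measureReal_def]
  congr 1
  have h := gaussianReal_map_neg (μ := 0) (v := 1)
  rw [neg_zero] at h
  conv_lhs => rw [← h, Measure.map_apply measurable_neg measurableSet_Iic]
  congr 1
  ext y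
  simp

lemma continuous_stdNormalCDF : Continuous stdNormalCDF := by
  have := nullSingletonClass_gaussianReal (μ := 0) (v := 1) one_ne_zero
  have h : Continuous (cdf (gaussianReal 0 1)) := by
    rw [continuous_iff_continuousAt]
    intro t
    rw [(monotone_cdf _).continuousAt_iff_leftLim_eq_rightLim, StieltjesFunction.rightLim_eq]
    have h1 := (cdf (gaussianReal 0 1)).measure_singleton t
    rw [measure_cdf, measure_singleton] at h1
    have h2 := ENNReal.ofReal_eq_zero.1 h1.symm
    exact le_antisymm ((monotone_cdf _).leftLim_le le_rfl) (by linarith)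
  exact h

lemma stdNormalCDF_quantile {p : ℝ} (h₀ : 0 < p) (h₁ : p < 1) :
    stdNormalCDF (stdNormalQuantile p) = p := by
  apply Function.invFun_eq
  have hb : ∀ᶠ t in Filter.atBot, stdNormalCDF t < p :=
    (tendsto_cdf_atBot (gaussianReal 0 1)).eventually_lt_const h₀
  have ht : ∀ᶠ t in Filter.atTop, p < stdNormalCDF t :=
    (tendsto_cdf_atTop (gaussianReal 0 1)).eventually_const_lt h₁
  obtain ⟨a, ha⟩ := hb.exists
  obtain ⟨b, hb⟩ := ht.exists
  exact mem_range_of_exists_le_of_exists_ge continuous_stdNormalCDF ⟨a, ha.le⟩ ⟨b, hb.le⟩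

lemma stdNormalCDF_kappa {ε : ℝ} (h₀ : 0 < ε) (h₁ : ε < 1) : stdNormalCDF (kappa ε) = 1 - ε := by
  rw [kappa, stdNormalCDF_neg, stdNormalCDF_quantile h₀ h₁]

lemma kappa_pos {ε : ℝ} (h₀ : 0 < ε) (h₁ : ε < 1 / 2) : 0 < kappa ε := by
  rw [← strictMono_stdNormalCDF.lt_iff_lt, stdNormalCDF_kappa h₀ (by linarith)]
  have := stdNormalCDF_neg 0
  rw [neg_zero] at this
  linarith

lemma map_inner_multivariateGaussian {n : ℕ} (v μ : EuclideanSpace ℝ (Fin n))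
    {S : Matrix (Fin n) (Fin n) ℝ} (hS : S.PosSemidef) :
    (multivariateGaussian μ S).map (fun ζ => ⟪v, ζ⟫) =
      gaussianReal ⟪v, μ⟫ (v.ofLp ⬝ᵥ S *ᵥ v.ofLp).toNNReal := by
  have h : (fun ζ => ⟪v, ζ⟫) = ⇑(innerSL ℝ v) := rfl
  rw [h, IsGaussian.map_eq_gaussianReal, ContinuousLinearMap.integral_comp_id_comm
    IsGaussian.integrable_id, integral_id_multivariateGaussian, ← h,
    ← covarianceBilin_self IsGaussian.memLp_two_id, covarianceBilin_multivariateGaussian hS]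

/-- For `q = 0` the law is a point mass, and `0 < ε < 1` makes both sides say `m ≤ a`. Otherwise
standardize. -/
lemma one_sub_le_gaussianReal_Iic_iff {ε : ℝ} (h₀ : 0 < ε) (h₁ : ε < 1) (m a : ℝ) {q : ℝ}
    (hq : 0 ≤ q) :
    1 - ε ≤ (gaussianReal m q.toNNReal).real (Set.Iic a) ↔ m + kappa ε * √q ≤ a := by
  rcases hq.eq_or_lt with rfl | hq
  · by_cases hma : m ≤ a
    · simp [gaussianReal_zero_var, measureReal_def, hma, h₀.le]
    · simp [gaussianReal_zero_var, measureReal_def, hma, h₁]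
  · have hs : 0 < √q := Real.sqrt_pos.2 hq
    have h : gaussianReal m q.toNNReal = (gaussianReal 0 1).map (fun t => m + √q * t) := by
      have hc : (fun t => m + √q * t) = (fun t => m + t) ∘ (fun t => √q * t) := rfl
      rw [hc, ← Measure.map_map (by fun_prop) (by fun_prop), gaussianReal_map_const_mul,
        gaussianReal_map_const_add]
      congr 1
      · simp
      · ext
        simp [Real.sq_sqrt hq.le, hq.le]
    have hpre : (fun t => m + √q * t) ⁻¹' Set.Iic a = Set.Iic ((a - m) / √q) := by
      ext t
      simp only [Set.mem_preimage, Set.mem_Iic, le_div_iff₀ hs]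
      constructor <;> intro h <;> linarith
    rw [h, measureReal_def, Measure.map_apply (by fun_prop) measurableSet_Iic, hpre,
      ← measureReal_def, ← stdNormalCDF_eq, ← stdNormalCDF_kappa h₀ h₁,
      strictMono_stdNormalCDF.le_iff_le, le_div_iff₀ hs]
    constructor <;> intro h <;> linarith

/-- The Gaussian chance constraint as a second-order cone constraint. -/
lemma linReliable_iff {n : ℕ} (g : EuclideanSpace ℝ (Fin n) → ℝ) (x : EuclideanSpace ℝ (Fin n))
    {ε : ℝ} (h₀ : 0 < ε) (h₁ : ε < 1) (μ : EuclideanSpace ℝ (Fin n))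
    {S : Matrix (Fin n) (Fin n) ℝ} (hS : S.PosSemidef) :
    LinReliable g x ε μ S ↔ g x + ⟪gradient g x, μ⟫ +
      kappa ε * √((gradient g x).ofLp ⬝ᵥ S *ᵥ (gradient g x).ofLp) ≤ 0 := by
  have hset : {ζ : EuclideanSpace ℝ (Fin n) | g x + ⟪gradient g x, ζ⟫ ≤ 0} =
      (fun ζ => ⟪gradient g x, ζ⟫) ⁻¹' Set.Iic (-g x) := by
    ext ζ
    simp only [Set.mem_ofPred_eq, Set.mem_preimage, Set.mem_Iic]
    constructor <;> intro h <;> linarith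
  have hq := hS.dotProduct_mulVec_nonneg (gradient g x).ofLp
  rw [star_trivial] at hq
  rw [LinReliable, hset, measureReal_def, ← Measure.map_apply (by fun_prop) measurableSet_Iic,
    map_inner_multivariateGaussian _ _ hS, ← measureReal_def,
    one_sub_le_gaussianReal_Iic_iff h₀ h₁ _ _ hq]
  constructor <;> intro h <;> linarith

/-! ### The bordered matrix and weak duality. -/

lemma borderedMatrix_quadForm {n : ℕ} (W : Matrix (Fin n) (Fin n) ℝ) (v y : Fin n → ℝ) (z t : ℝ) :
    Sum.elim y (fun _ : Unit => t) ⬝ᵥ borderedMatrix W v z *ᵥ Sum.elim y (fun _ : Unit => t) =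
      y ⬝ᵥ W *ᵥ y + t * (v ⬝ᵥ y) + z * t ^ 2 := by
  have h : (fun i => v i / 2) = (2⁻¹ : ℝ) • v := by ext i; simp; ring
  have h1 : replicateCol Unit (fun i => v i / 2) *ᵥ (fun _ => t) = (t / 2) • v := by
    ext i; simp [mulVec, dotProduct]; ring
  have h2 : replicateRow Unit (fun i => v i / 2) *ᵥ y = fun _ => (v ⬝ᵥ y) / 2 := by
    ext i
    rw [h]
    change ((2⁻¹ : ℝ) • v) ⬝ᵥ y = _
    rw [smul_dotProduct, smul_eq_mul]; ring
  have h3 : (of fun _ _ => z : Matrix Unit Unit ℝ) *ᵥ (fun _ => t) = fun _ => z * t := by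
    ext i; simp [mulVec, dotProduct]
  rw [borderedMatrix, fromBlocks_mulVec, dotProduct_block]
  simp only [Sum.elim_comp_inl, Sum.elim_comp_inr, h1, h2, h3, dotProduct_add, dotProduct_smul,
    smul_eq_mul]
  rw [dotProduct_comm y v]
  simp only [dotProduct, Finset.univ_unique, Finset.sum_singleton]
  ring

lemma posSemidef_borderedMatrix_iff {n : ℕ} {W : Matrix (Fin n) (Fin n) ℝ} (hW : W.IsSymm)
    (v : Fin n → ℝ) (z : ℝ) :
    (borderedMatrix W v z).PosSemidef ↔
      ∀ y t, 0 ≤ y ⬝ᵥ W *ᵥ y + t * (v ⬝ᵥ y) + z * t ^ 2 := by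
  rw [posSemidef_iff_dotProduct_mulVec]
  constructor
  · rintro ⟨-, h⟩ y t
    rw [← borderedMatrix_quadForm]
    simpa using h (Sum.elim y (fun _ => t))
  · intro h
    refine ⟨?_, fun u => ?_⟩
    · rw [IsHermitian, conjTranspose_eq_transpose_of_trivial, borderedMatrix,
        fromBlocks_transpose, hW.eq]
      rfl
    · have hu : u = Sum.elim (u ∘ Sum.inl) (fun _ => u (Sum.inr ())) := by
        ext (i | i) <;> rfl
      rw [star_trivial, hu, borderedMatrix_quadForm]
      exact h _ _

/-- Weak duality for the worst-case standard deviation. -/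
lemma kappa_mul_sqrt_le {n : ℕ} {S W : Matrix (Fin n) (Fin n) ℝ} (hS : S.PosSemidef)
    {v : Fin n → ℝ} {z c : ℝ}
    (h : ∀ y t, 0 ≤ y ⬝ᵥ W *ᵥ y + t * (v ⬝ᵥ y) + z * t ^ 2) :
    c * √(v ⬝ᵥ S *ᵥ v) ≤ frobInner S W + c ^ 2 * z := by
  obtain ⟨C, rfl⟩ : ∃ C : Matrix (Fin n) (Fin n) ℝ, S = Cᵀ * C := by
    open scoped MatrixOrder in
    obtain ⟨C, hC⟩ := CStarAlgebra.nonneg_iff_eq_star_mul_self.1 hS.nonneg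
    exact ⟨C, hC⟩
  have hz : 0 ≤ z := by simpa using h 0 1
  have hq : v ⬝ᵥ (Cᵀ * C) *ᵥ v = ∑ i, (v ⬝ᵥ C i) ^ 2 := by
    rw [← mulVec_mulVec, dotProduct_mulVec, vecMul_transpose, dotProduct]
    refine Finset.sum_congr rfl fun i _ => ?_
    rw [dotProduct_comm v, sq]
    rfl
  have hF : frobInner (Cᵀ * C) W = ∑ i, C i ⬝ᵥ W *ᵥ C i := by
    rw [frobInner, transpose_mul, transpose_transpose, Matrix.mul_assoc, trace_mul_comm, trace]
    refine Finset.sum_congr rfl fun i _ => ?_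
    rw [diag_apply, Matrix.mul_assoc, mul_apply]
    rfl
  rw [hF]
  set q := v ⬝ᵥ (Cᵀ * C) *ᵥ v
  -- Test the form at each row `C i` with `t = -s (v ⬝ᵥ C i)` and sum over `i`.
  have hsum : ∀ s : ℝ, 0 ≤ (∑ i, C i ⬝ᵥ W *ᵥ C i) - s * q + z * s ^ 2 * q := by
    intro s
    have := Finset.sum_nonneg fun i (_ : i ∈ Finset.univ) => h (C i) (-s * (v ⬝ᵥ C i))
    refine this.trans_eq ?_
    rw [hq, Finset.mul_sum, Finset.mul_sum, ← Finset.sum_sub_distrib, ← Finset.sum_add_distrib]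
    exact Finset.sum_congr rfl fun i _ => by ring
  have hq0 : 0 ≤ q := hq ▸ Finset.sum_nonneg fun i _ => sq_nonneg _
  rcases hq0.eq_or_lt with h0 | h0
  · rw [← h0, Real.sqrt_zero, mul_zero]
    have := hsum 0
    have := mul_nonneg (sq_nonneg c) hz
    linarith
  -- This `s` turns the linear term into `c√q` and the quadratic one into `c²z`.
  · have := hsum (c / √q)
    have hs : 0 < √q := Real.sqrt_pos.2 h0
    have e1 : c / √q * q = c * √q := by
      nth_rewrite 2 [← Real.mul_self_sqrt h0.le]; field_simp
    have e2 : z * (c / √q) ^ 2 * q = c ^ 2 * z := by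
      rw [div_pow, Real.sq_sqrt h0.le]; field_simp
    linarith

/-! ### Entrywise norms and their duality. -/

lemma frobInner_eq_sum {m n : ℕ} (X Y : Matrix (Fin m) (Fin n) ℝ) :
    frobInner X Y = ∑ i, ∑ j, X i j * Y i j := by
  simp only [frobInner, trace, diag_apply, mul_apply, transpose_apply]
  exact Finset.sum_comm

lemma abs_le_normInfInf {m n : ℕ} (Z : Matrix (Fin m) (Fin n) ℝ) (i : Fin m) (j : Fin n) :
    |Z i j| ≤ normInfInf Z :=
  le_ciSup (f := fun p : Fin m × Fin n => |Z p.1 p.2|) (Set.finite_range _).bddAbove (i, j)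

lemma normInfInf_le_iff {m n : ℕ} {Z : Matrix (Fin m) (Fin n) ℝ} {β : ℝ} (hβ : 0 ≤ β) :
    normInfInf Z ≤ β ↔ ∀ i j, |Z i j| ≤ β :=
  ⟨fun h i j => (abs_le_normInfInf Z i j).trans h, fun h => Real.iSup_le (fun _ => h _ _) hβ⟩

lemma normInf_le_iff {n : ℕ} {z : Fin n → ℝ} {α : ℝ} (hα : 0 ≤ α) :
    normInf z ≤ α ↔ ∀ i, |z i| ≤ α :=
  ⟨fun h i => (le_ciSup (Set.finite_range _).bddAbove i).trans h, fun h => Real.iSup_le h hα⟩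

lemma frobInner_le {m n : ℕ} {Z X : Matrix (Fin m) (Fin n) ℝ} {β : ℝ}
    (hZ : ∀ i j, |Z i j| ≤ β) : frobInner Z X ≤ β * norm11 X := by
  rw [frobInner_eq_sum, norm11, Finset.mul_sum]
  refine Finset.sum_le_sum fun i _ => ?_
  rw [Finset.mul_sum]
  refine Finset.sum_le_sum fun j _ => (le_abs_self _).trans ?_
  rw [abs_mul]
  exact mul_le_mul_of_nonneg_right (hZ i j) (abs_nonneg _)

/-- The sign matrix attains equality in `frobInner_le`. -/
lemma frobInner_sign {m n : ℕ} (X : Matrix (Fin m) (Fin n) ℝ) (β : ℝ) :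
    frobInner (of fun i j => β * SignType.sign (X i j)) X = β * norm11 X := by
  rw [frobInner_eq_sum, norm11, Finset.mul_sum]
  refine Finset.sum_congr rfl fun i _ => ?_
  rw [Finset.mul_sum]
  exact Finset.sum_congr rfl fun j _ => by rw [of_apply, mul_assoc, sign_mul_self]

lemma abs_mul_sign_le {β : ℝ} (hβ : 0 ≤ β) (r : ℝ) : |β * (SignType.sign r : ℝ)| ≤ β := by
  rcases lt_trichotomy r 0 with h | h | h <;> simp [h, hβ, abs_of_nonneg]

lemma frobInner_add_left {m n : ℕ} (X Y W : Matrix (Fin m) (Fin n) ℝ) :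
    frobInner (X + Y) W = frobInner X W + frobInner Y W := by
  simp [frobInner, Matrix.add_mul]

lemma frobInner_add_right {m n : ℕ} (X Y W : Matrix (Fin m) (Fin n) ℝ) :
    frobInner X (Y + W) = frobInner X Y + frobInner X W := by
  simp [frobInner, Matrix.mul_add]

lemma frobInner_congruence {n k : ℕ} (B : Matrix (Fin n) (Fin k) ℝ) (Z : Matrix (Fin k) (Fin k) ℝ)
    (W : Matrix (Fin n) (Fin n) ℝ) : frobInner (B * Z * Bᵀ) W = frobInner Z (Bᵀ * W * B) := by
  simp only [frobInner, transpose_mul, transpose_transpose, Matrix.mul_assoc]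
  rw [trace_mul_comm]
  simp only [Matrix.mul_assoc]

lemma frobInner_vecMulVec {n : ℕ} (S : Matrix (Fin n) (Fin n) ℝ) (v : Fin n → ℝ) :
    frobInner S (vecMulVec v v) = v ⬝ᵥ S *ᵥ v := by
  rw [frobInner_eq_sum]
  simp only [dotProduct, mulVec, vecMulVec_apply, Finset.mul_sum]
  exact Finset.sum_congr rfl fun i _ => Finset.sum_congr rfl fun j _ => by ring

/-! ### Strong duality by separation. -/

/-- Matrices, not necessarily symmetric, whose quadratic form is positive definite. -/
def posQuadForms (n : ℕ) : Set (Matrix (Fin n) (Fin n) ℝ) :=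
  {N | ∀ y, y ≠ 0 → 0 < y ⬝ᵥ N *ᵥ y}

/-- By homogeneity the unit sphere suffices, and its compactness makes the strict inequality stable.
-/
lemma isOpen_posQuadForms (n : ℕ) : IsOpen (posQuadForms n) := by
  have h : posQuadForms n =
      {N | ∀ y ∈ Metric.sphere (0 : Fin n → ℝ) 1, 0 < y ⬝ᵥ N *ᵥ y} := by
    ext N
    constructor
    · intro h y hy
      exact h y (ne_zero_of_mem_unit_sphere ⟨y, hy⟩)
    · intro h y hy
      have hy' : 0 < ‖y‖ := norm_pos_iff.2 hy
      have := h (‖y‖⁻¹ • y) (by simp [norm_smul, hy'.ne'])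
      rw [mulVec_smul, dotProduct_smul, smul_dotProduct, smul_eq_mul, smul_eq_mul,
        ← mul_assoc] at this
      exact pos_of_mul_pos_right this (by positivity)
  rw [h, isOpen_iff_eventually]
  intro N hN
  refine (isCompact_sphere (0 : Fin n → ℝ) 1).eventually_forall_of_forall_eventually
    fun y hy => ?_
  have hc : Continuous fun p : Matrix (Fin n) (Fin n) ℝ × (Fin n → ℝ) =>
      p.2 ⬝ᵥ p.1 *ᵥ p.2 := by fun_prop
  exact (hc.tendsto (N, y)).eventually_const_lt (hN y hy)

lemma convex_posQuadForms (n : ℕ) : Convex ℝ (posQuadForms n) := by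
  intro M hM N hN a b ha hb hab y hy
  rw [add_mulVec, smul_mulVec, smul_mulVec, dotProduct_add, dotProduct_smul, dotProduct_smul,
    smul_eq_mul, smul_eq_mul]
  have h1 := hM y hy
  have h2 := hN y hy
  rcases ha.eq_or_lt with rfl | ha
  · obtain rfl : b = 1 := by linarith
    simpa using h2
  · have := mul_pos ha h1
    have := mul_nonneg hb h2.le
    linarith

/-- The matrices and reals lying strictly below `(S, vᵀ S v)` for some
`S = S₀ + B Z Bᵀ` with `Z` in the convex set `K`. -/
def strictHypograph {n k : ℕ} (S₀ : Matrix (Fin n) (Fin n) ℝ) (B : Matrix (Fin n) (Fin k) ℝ)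
    (K : Set (Matrix (Fin k) (Fin k) ℝ)) (v : Fin n → ℝ) :
    Set (Matrix (Fin n) (Fin n) ℝ × ℝ) :=
  {p | ∃ Z ∈ K, S₀ + B * Z * Bᵀ - p.1 ∈ posQuadForms n ∧
    p.2 < v ⬝ᵥ (S₀ + B * Z * Bᵀ) *ᵥ v}

section
variable {n k : ℕ} (S₀ : Matrix (Fin n) (Fin n) ℝ) (B : Matrix (Fin n) (Fin k) ℝ)
    (K : Set (Matrix (Fin k) (Fin k) ℝ)) (v : Fin n → ℝ)

lemma isOpen_strictHypograph : IsOpen (strictHypograph S₀ B K v) := by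
  have h : strictHypograph S₀ B K v = ⋃ Z ∈ K, {p : Matrix (Fin n) (Fin n) ℝ × ℝ |
      S₀ + B * Z * Bᵀ - p.1 ∈ posQuadForms n ∧ p.2 < v ⬝ᵥ (S₀ + B * Z * Bᵀ) *ᵥ v} := by
    ext p
    simp only [strictHypograph, Set.mem_iUnion, exists_prop]
    rfl
  rw [h]
  refine isOpen_biUnion fun Z _ => IsOpen.and ?_ ?_
  · exact (isOpen_posQuadForms n).preimage (by fun_prop)
  · exact isOpen_lt (by fun_prop) (by fun_prop)

lemma convex_strictHypograph (hK : Convex ℝ K) : Convex ℝ (strictHypograph S₀ B K v) := by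
  rintro ⟨M, r⟩ ⟨Z, hZ, hM, hr⟩ ⟨M', r'⟩ ⟨Z', hZ', hM', hr'⟩ a b ha hb hab
  have e : S₀ + B * (a • Z + b • Z') * Bᵀ = a • (S₀ + B * Z * Bᵀ) + b • (S₀ + B * Z' * Bᵀ) := by
    rw [Matrix.mul_add, Matrix.add_mul, smul_add, smul_add]
    nth_rewrite 1 [← one_smul ℝ S₀]
    rw [← hab, add_smul]
    simp only [Matrix.mul_smul, Matrix.smul_mul]
    abel
  refine ⟨a • Z + b • Z', hK hZ hZ' ha hb hab, ?_, ?_⟩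
  · rw [e]
    convert convex_posQuadForms n hM hM' ha hb hab using 1
    simp only [Prod.smul_mk, Prod.mk_add_mk, smul_sub]
    abel
  · rw [e]
    simp only [Prod.smul_mk, Prod.mk_add_mk, add_mulVec (a • _), smul_mulVec _ (S₀ + _),
      dotProduct_add _ (a • _), dotProduct_smul, smul_eq_mul]
    rcases ha.eq_or_lt with rfl | ha
    · obtain rfl : b = 1 := by linarith
      simpa using hr'
    · have := mul_lt_mul_of_pos_left hr ha
      have := mul_le_mul_of_nonneg_left hr'.le hb
      simp only at *
      linarith

end

/-- The hypothesis covers nonsymmetric `Q`. Antisymmetric matrices have zero form with either sign,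
so `φ` vanishes on them and `Y` is symmetric; `Q = yyᵀ` gives semidefiniteness. -/
lemma exists_posSemidef_frobInner_eq {n : ℕ} {φ : Matrix (Fin n) (Fin n) ℝ →ₗ[ℝ] ℝ}
    (hφ : ∀ Q : Matrix (Fin n) (Fin n) ℝ, (∀ y, 0 ≤ y ⬝ᵥ Q *ᵥ y) → 0 ≤ φ Q) :
    ∃ Y : Matrix (Fin n) (Fin n) ℝ, Y.PosSemidef ∧ ∀ M, φ M = frobInner M Y := by
  have hrep : ∀ M, φ M = frobInner M (of fun i j => φ (single i j 1)) := by
    intro M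
    nth_rewrite 1 [matrix_eq_sum_single M]
    rw [frobInner_eq_sum]
    simp only [map_sum, of_apply]
    refine Finset.sum_congr rfl fun i _ => Finset.sum_congr rfl fun j _ => ?_
    rw [← smul_eq_mul, ← map_smul, smul_single, smul_eq_mul, mul_one]
  refine ⟨of fun i j => φ (single i j 1), ?_, hrep⟩
  refine PosSemidef.of_dotProduct_mulVec_nonneg ?_ fun y => ?_
  · have key : ∀ i j, φ (single i j 1) ≤ φ (single j i 1) := by
      intro i j
      have := hφ (single j i 1 - single i j 1) fun y => by
        rw [sub_mulVec, dotProduct_sub, single_mulVec, single_mulVec]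
        change 0 ≤ y ⬝ᵥ Pi.single j (1 * y i) - y ⬝ᵥ Pi.single i (1 * y j)
        rw [dotProduct_single, dotProduct_single]
        exact le_of_eq (by ring)
      rw [map_sub] at this
      linarith
    ext i j
    simpa using le_antisymm (key j i) (key i j)
  · have := hφ (vecMulVec y y) fun u => by
      rw [vecMulVec_mulVec, op_smul_eq_smul, dotProduct_smul, dotProduct_comm u, smul_eq_mul]
      exact mul_self_nonneg _
    rw [hrep, frobInner_eq_sum] at this
    simp only [vecMulVec_apply] at this
    simp only [dotProduct, mulVec, Finset.mul_sum, star_trivial]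
    refine this.trans_eq (Finset.sum_congr rfl fun i _ => Finset.sum_congr rfl fun j _ => ?_)
    simp only [of_apply]
    ring

lemma PosDef.mem_posQuadForms {n : ℕ} {S : Matrix (Fin n) (Fin n) ℝ} (hS : S.PosDef) :
    S ∈ posQuadForms n :=
  fun y hy => by simpa using hS.dotProduct_mulVec_pos hy

/-- Strong duality for maximizing `vᵀ S v` over the positive semidefinite matrices
`S = S₀ + B Z Bᵀ`, with `Z` in a convex set of symmetric matrices containing `0`. -/
lemma exists_dual_certificate {n k : ℕ} {S₀ : Matrix (Fin n) (Fin n) ℝ} (hS₀ : S₀.PosDef)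
    (B : Matrix (Fin n) (Fin k) ℝ) {K : Set (Matrix (Fin k) (Fin k) ℝ)} (hK : Convex ℝ K)
    (hK0 : 0 ∈ K) (hKs : ∀ Z ∈ K, Z.IsSymm) (v : Fin n → ℝ) (s : ℝ)
    (hs : ∀ Z ∈ K, (S₀ + B * Z * Bᵀ).PosSemidef → v ⬝ᵥ (S₀ + B * Z * Bᵀ) *ᵥ v ≤ s) :
    ∃ Y : Matrix (Fin n) (Fin n) ℝ, Y.PosSemidef ∧
      ∀ Z ∈ K, frobInner (S₀ + B * Z * Bᵀ) (Y + vecMulVec v v) ≤ s := by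
  have hsymm : ∀ Z ∈ K, (S₀ + B * Z * Bᵀ).IsHermitian := by
    intro Z hZ
    have h0 : S₀ᵀ = S₀ := by simpa using hS₀.isHermitian.eq
    rw [IsHermitian, conjTranspose_eq_transpose_of_trivial, transpose_add, transpose_mul,
      transpose_mul, transpose_transpose, (hKs Z hZ).eq, h0, Matrix.mul_assoc]
  have hnot : ((0 : Matrix (Fin n) (Fin n) ℝ), s) ∉ strictHypograph S₀ B K v := by
    rintro ⟨Z, hZ, hpos, hlt⟩
    rw [sub_zero] at hpos
    refine hlt.not_ge (hs Z hZ (PosSemidef.of_dotProduct_mulVec_nonneg (hsymm Z hZ) fun y => ?_))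
    by_cases hy : y = 0
    · simp [hy]
    · simpa using (hpos y hy).le
  obtain ⟨f, hf⟩ := geometric_hahn_banach_open_point (convex_strictHypograph S₀ B K v hK)
    (isOpen_strictHypograph S₀ B K v) hnot
  set l : ℝ := f (0, 1) with hl
  have hsplit : ∀ M r, f (M, r) = f (M, 0) + r * l := by
    intro M r
    rw [hl, ← smul_eq_mul, ← map_smul, ← map_add]
    simp
  -- Slater's condition: since `S₀ ≻ 0`, the hypograph has a point straight below `(0, s)`, so the
  -- separating hyperplane is not vertical.
  have hlpos : 0 < l := by
    have h1 := hf (0, min s (v ⬝ᵥ S₀ *ᵥ v) - 1) ⟨0, hK0, by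
      simpa using PosDef.mem_posQuadForms hS₀, by
        have := min_le_right s (v ⬝ᵥ S₀ *ᵥ v)
        simp only [Matrix.mul_zero, Matrix.zero_mul, add_zero]
        linarith⟩
    rw [hsplit, hsplit 0 s] at h1
    have h2 := min_le_left s (v ⬝ᵥ S₀ *ᵥ v)
    by_contra hneg
    nlinarith [not_lt.1 hneg]
  let φ : Matrix (Fin n) (Fin n) ℝ →ₗ[ℝ] ℝ := l⁻¹ • (f.toLinearMap ∘ₗ LinearMap.inl ℝ _ ℝ)
  have hφ : ∀ M, f (M, 0) = l * φ M := fun M => by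
    simp [φ, hlpos.ne']
  have hbound : ∀ Z ∈ K, ∀ Q : Matrix (Fin n) (Fin n) ℝ, (∀ y, 0 ≤ y ⬝ᵥ Q *ᵥ y) →
      φ (S₀ + B * Z * Bᵀ) - φ Q + v ⬝ᵥ (S₀ + B * Z * Bᵀ) *ᵥ v ≤ s := by
    intro Z hZ Q hQ
    set T := S₀ + B * Z * Bᵀ with hT
    -- Subtracting `t` in both coordinates moves the boundary point into the open hypograph; then `t
    -- → 0`.
    have hlt : ∀ t : ℝ, 0 < t → φ T - φ Q + v ⬝ᵥ T *ᵥ v - t * (φ 1 + 1) ≤ s := by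
      intro t ht
      have h1 := hf (T - Q - t • 1, v ⬝ᵥ T *ᵥ v - t) ⟨Z, hZ, by
        intro y hy
        have h3 : 0 < y ⬝ᵥ y := by simpa using dotProduct_star_self_pos_iff.2 hy
        rw [← hT, show T - (T - Q - t • 1) = Q + t • 1 by abel, add_mulVec, smul_mulVec,
          one_mulVec, dotProduct_add, dotProduct_smul, smul_eq_mul]
        exact add_pos_of_nonneg_of_pos (hQ y) (mul_pos ht h3), by simp [← hT, ht]⟩
      rw [hsplit, hsplit 0 s, hφ, hφ, map_zero, mul_zero, zero_add, map_sub, map_sub, map_smul,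
        smul_eq_mul] at h1
      refine le_of_mul_le_mul_left ?_ hlpos
      linarith
    have hlim : Filter.Tendsto (fun t : ℝ => φ T - φ Q + v ⬝ᵥ T *ᵥ v - t * (φ 1 + 1))
        (nhdsWithin 0 (Set.Ioi 0)) (nhds (φ T - φ Q + v ⬝ᵥ T *ᵥ v - 0 * (φ 1 + 1))) :=
      (Continuous.tendsto (by fun_prop) 0).mono_left nhdsWithin_le_nhds
    rw [zero_mul, sub_zero] at hlim
    exact le_of_tendsto hlim (Filter.eventually_of_mem self_mem_nhdsWithin hlt)
  obtain ⟨Y, hY, hrep⟩ := exists_posSemidef_frobInner_eq (φ := φ) fun Q hQ => by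
    by_contra hneg
    have hneg := not_le.1 hneg
    set a := φ (S₀ + B * (0 : Matrix (Fin k) (Fin k) ℝ) * Bᵀ) +
      v ⬝ᵥ (S₀ + B * (0 : Matrix (Fin k) (Fin k) ℝ) * Bᵀ) *ᵥ v - s with ha
    -- If `φ Q < 0`, this large multiple of `Q` violates `hbound` at `Z = 0`.
    have h1 := hbound 0 hK0 (((|a| + 1) / -φ Q) • Q) fun y => by
      rw [smul_mulVec, dotProduct_smul]
      exact mul_nonneg (div_nonneg (by positivity) (by linarith)) (hQ y)
    have h2 : (|a| + 1) / -φ Q * φ Q = -(|a| + 1) := by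
      rw [div_mul_eq_mul_div, div_neg, mul_div_cancel_right₀ _ hneg.ne]
    rw [map_smul, smul_eq_mul, h2] at h1
    have := neg_abs_le a
    linarith
  refine ⟨Y, hY, fun Z hZ => ?_⟩
  have := hbound Z hZ 0 (by simp)
  rw [frobInner_add_right, ← hrep, frobInner_vecMulVec]
  simpa using this

/-! ### Worst-case mean, worst-case covariance, and the theorem. -/

lemma dotProduct_le_norm1 {n : ℕ} {z w : Fin n → ℝ} {α : ℝ} (hz : ∀ i, |z i| ≤ α) :
    z ⬝ᵥ w ≤ α * norm1 w := by
  rw [dotProduct, norm1, Finset.mul_sum]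
  refine Finset.sum_le_sum fun j _ => (le_abs_self _).trans ?_
  rw [abs_mul]
  exact mul_le_mul_of_nonneg_right (hz j) (abs_nonneg _)

lemma sign_dotProduct {n : ℕ} (w : Fin n → ℝ) (α : ℝ) :
    (fun i => α * (SignType.sign (w i) : ℝ)) ⬝ᵥ w = α * norm1 w := by
  rw [dotProduct, norm1, Finset.mul_sum]
  exact Finset.sum_congr rfl fun j _ => by rw [mul_assoc, sign_mul_self]

lemma inner_toLp_mulVec {n m : ℕ} (v : EuclideanSpace ℝ (Fin n)) (A : Matrix (Fin n) (Fin m) ℝ)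
    (z : Fin m → ℝ) : ⟪v, WithLp.toLp 2 (A *ᵥ z)⟫ = z ⬝ᵥ Aᵀ *ᵥ v.ofLp := by
  rw [EuclideanSpace.inner_eq_star_dotProduct, star_trivial, mulVec_transpose,
    dotProduct_comm z, ← dotProduct_mulVec, dotProduct_comm]

/-- Robustness over both uncertainty sets reduces to robustness over the covariance matrix. -/
lemma forall_linReliable_iff {n m k : ℕ} (g : EuclideanSpace ℝ (Fin n) → ℝ)
    (x : EuclideanSpace ℝ (Fin n)) {ε : ℝ} (h₀ : 0 < ε) (h₁ : ε < 1)
    (μ₀ : EuclideanSpace ℝ (Fin n)) (S₀ : Matrix (Fin n) (Fin n) ℝ)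
    (A : Matrix (Fin n) (Fin m) ℝ) (B : Matrix (Fin n) (Fin k) ℝ) {α : ℝ} (β : ℝ) (hα : 0 ≤ α) :
    (∀ μ ∈ meanSet μ₀ A α, ∀ S ∈ covSet S₀ B β, LinReliable g x ε μ S) ↔
      ∀ S ∈ covSet S₀ B β, g x + ⟪gradient g x, μ₀⟫ + α * norm1 (Aᵀ *ᵥ (gradient g x).ofLp) +
        kappa ε * √((gradient g x).ofLp ⬝ᵥ S *ᵥ (gradient g x).ofLp) ≤ 0 := by
  constructor
  · intro h S hS
    set w := Aᵀ *ᵥ (gradient g x).ofLp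
    have := h (μ₀ + WithLp.toLp 2 (A *ᵥ fun i => α * (SignType.sign (w i) : ℝ)))
      ⟨_, (normInf_le_iff hα).2 fun i => abs_mul_sign_le hα _, rfl⟩ S hS
    rw [linReliable_iff g x h₀ h₁ _ hS.2, inner_add_right, inner_toLp_mulVec,
      sign_dotProduct] at this
    linarith
  · rintro h _ ⟨z, hz, rfl⟩ S hS
    rw [linReliable_iff g x h₀ h₁ _ hS.2, inner_add_right, inner_toLp_mulVec]
    have h1 := h S hS
    have h2 := dotProduct_le_norm1 (w := Aᵀ *ᵥ (gradient g x).ofLp) ((normInf_le_iff hα).1 hz)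
    linarith

/-- Semidefinite dual of the worst-case standard deviation bound over `covSet S₀ B β`. -/
lemma forall_covSet_kappa_mul_sqrt_le_iff {n k : ℕ} {S₀ : Matrix (Fin n) (Fin n) ℝ}
    (hS₀ : S₀.PosDef) (B : Matrix (Fin n) (Fin k) ℝ) {β : ℝ} (hβ : 0 ≤ β) (v : Fin n → ℝ)
    {κ : ℝ} (hκ : 0 < κ) (c : ℝ) :
    (∀ S ∈ covSet S₀ B β, κ * √(v ⬝ᵥ S *ᵥ v) ≤ c) ↔
      ∃ (z : ℝ) (W : Matrix (Fin n) (Fin n) ℝ), W.IsSymm ∧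
        frobInner S₀ W + β * norm11 (Bᵀ * W * B) + κ ^ 2 * z ≤ c ∧
        (borderedMatrix W v z).PosSemidef := by
  constructor
  · intro h
    have hS₀U : S₀ ∈ covSet S₀ B β :=
      ⟨⟨0, by simp, (normInfInf_le_iff hβ).2 (by simp [hβ]), by simp⟩, hS₀.posSemidef⟩
    have hc := h S₀ hS₀U
    -- Here `c = 0` is possible, which would spoil the scaling `κ² / (2c)` used below.
    by_cases hv : v = 0
    · subst hv
      refine ⟨0, 0, isSymm_zero, ?_, ?_⟩
      · simpa [frobInner, norm11] using hc
      · rw [posSemidef_borderedMatrix_iff isSymm_zero]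
        simp
    have hq : 0 < v ⬝ᵥ S₀ *ᵥ v := PosDef.mem_posQuadForms hS₀ v hv
    have hc0 : 0 < c := (mul_pos hκ (Real.sqrt_pos.2 hq)).trans_le hc
    -- Semidefiniteness is left out of `K`; the multiplier `Y` accounts for it.
    let K : Set (Matrix (Fin k) (Fin k) ℝ) := {Z | Z.IsSymm ∧ ∀ i j, |Z i j| ≤ β}
    have hK : Convex ℝ K := by
      rintro Z ⟨hZ, hZβ⟩ Z' ⟨hZ', hZβ'⟩ a b ha hb hab
      refine ⟨(hZ.smul a).add (hZ'.smul b), fun i j => ?_⟩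
      have := convex_Icc (-β) β (abs_le.1 (hZβ i j)) (abs_le.1 (hZβ' i j)) ha hb hab
      exact abs_le.2 this
    obtain ⟨Y, hY, hdual⟩ := exists_dual_certificate hS₀ B hK ⟨isSymm_zero, by simp [hβ]⟩
      (fun Z hZ => hZ.1) v ((c / κ) ^ 2) fun Z hZ hpos => by
        have h1 := h _ ⟨⟨Z, hZ.1, (normInfInf_le_iff hβ).2 hZ.2, rfl⟩, hpos⟩
        rw [mul_comm, ← le_div_iff₀ hκ] at h1
        exact (Real.sqrt_le_left (by positivity)).1 h1
    set V := Y + vecMulVec v v with hV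
    have hYs : Y.IsSymm := by simpa [IsHermitian, IsSymm] using hY.isHermitian
    have hVs : V.IsSymm := hYs.add (transpose_vecMulVec v v)
    have hXs : (Bᵀ * V * B).IsSymm := by
      rw [IsSymm, transpose_mul, transpose_mul, transpose_transpose, hVs.eq, Matrix.mul_assoc]
    have hbound : frobInner S₀ V + β * norm11 (Bᵀ * V * B) ≤ (c / κ) ^ 2 := by
      -- The maximizing `Z` is admissible because the signs of a symmetric matrix form a symmetric
      -- matrix.
      have := hdual (of fun i j => β * (SignType.sign ((Bᵀ * V * B) i j) : ℝ))
        ⟨by ext i j; simp only [transpose_apply, of_apply, hXs.apply i j],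
          fun i j => abs_mul_sign_le hβ _⟩
      rwa [frobInner_add_left, frobInner_congruence, frobInner_sign] at this
    -- With `W = rV`, the term `r vvᵀ` calls for `z = 1/(4r)`. The bound `r(c/κ)² + κ²/(4r)` is
    -- least at this `r`, where both terms equal `c/2`.
    have hr : 0 < κ ^ 2 / (2 * c) := by positivity
    set r := κ ^ 2 / (2 * c) with hrdef
    refine ⟨c / (2 * κ ^ 2), r • V, hVs.smul r, ?_, ?_⟩
    · have e1 : frobInner S₀ (r • V) = r * frobInner S₀ V := by
        simp [frobInner]
      have e2 : norm11 (Bᵀ * (r • V) * B) = r * norm11 (Bᵀ * V * B) := by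
        simp [norm11, abs_mul, abs_of_pos hr, Finset.mul_sum]
      have e3 : r * (c / κ) ^ 2 = c / 2 := by rw [hrdef]; field_simp
      have e4 : κ ^ 2 * (c / (2 * κ ^ 2)) = c / 2 := by field_simp
      have := mul_le_mul_of_nonneg_left hbound hr.le
      rw [e1, e2, e4]
      linarith
    · rw [posSemidef_borderedMatrix_iff (hVs.smul r)]
      intro y t
      have hYy : 0 ≤ y ⬝ᵥ Y *ᵥ y := by simpa using hY.dotProduct_mulVec_nonneg y
      have e1 : y ⬝ᵥ (r • V) *ᵥ y = r * (y ⬝ᵥ Y *ᵥ y) + r * (v ⬝ᵥ y) ^ 2 := by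
        rw [hV, smul_mulVec, add_mulVec, vecMulVec_mulVec, dotProduct_smul, dotProduct_add]
        simp only [dotProduct_smul, dotProduct_comm y v, op_smul_eq_smul, smul_eq_mul]
        ring
      have e2 : c / (2 * κ ^ 2) = (4 * r)⁻¹ := by rw [hrdef]; field_simp; norm_num
      have e3 : r * (v ⬝ᵥ y) ^ 2 + t * (v ⬝ᵥ y) + (4 * r)⁻¹ * t ^ 2 =
          r * (v ⬝ᵥ y + t / (2 * r)) ^ 2 := by field_simp; ring
      have := mul_nonneg hr.le hYy
      have := mul_nonneg hr.le (sq_nonneg (v ⬝ᵥ y + t / (2 * r)))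
      rw [e1, e2]
      linarith
  · rintro ⟨z, W, hW, hle, hpsd⟩ S ⟨⟨Z, -, hZ, rfl⟩, hpos⟩
    have h1 := kappa_mul_sqrt_le (c := κ) hpos ((posSemidef_borderedMatrix_iff hW v z).1 hpsd)
    rw [frobInner_add_left, frobInner_congruence] at h1
    have h2 := frobInner_le (X := Bᵀ * W * B) ((normInfInf_le_iff hβ).1 hZ)
    linarith

end RobustReliability

theorem theorem4 {n m k : ℕ}
    (g : EuclideanSpace ℝ (Fin n) → ℝ) (hg : Differentiable ℝ g)
    (x : EuclideanSpace ℝ (Fin n))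
    (ε : ℝ) (hε₀ : 0 < ε) (hε₁ : ε < 1 / 2)
    (μ₀ : EuclideanSpace ℝ (Fin n))
    (S₀ : Matrix (Fin n) (Fin n) ℝ) (hS₀ : S₀.PosDef)
    (A : Matrix (Fin n) (Fin m) ℝ) (B : Matrix (Fin n) (Fin k) ℝ)
    (α β : ℝ) (hα : 0 ≤ α) (hβ : 0 ≤ β) :
    (∀ μ ∈ meanSet μ₀ A α, ∀ S ∈ covSet S₀ B β, LinReliable g x ε μ S) ↔
      ∃ (z : ℝ) (W : Matrix (Fin n) (Fin n) ℝ), W.IsSymm ∧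
        g x + ⟪gradient g x, μ₀⟫ + α * norm1 (Aᵀ *ᵥ (gradient g x).ofLp)
            + frobInner S₀ W + β * norm11 (Bᵀ * W * B) + kappa ε ^ 2 * z ≤ 0 ∧
        (borderedMatrix W (gradient g x).ofLp z).PosSemidef := by
  rw [forall_linReliable_iff g x hε₀ (by linarith) μ₀ S₀ A B β hα]
  have key := forall_covSet_kappa_mul_sqrt_le_iff hS₀ B hβ (gradient g x).ofLp
    (kappa_pos hε₀ hε₁) (-(g x + ⟪gradient g x, μ₀⟫ + α * norm1 (Aᵀ *ᵥ (gradient g x).ofLp)))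
  constructor
  · intro h
    obtain ⟨z, W, hW, hle, hpsd⟩ := key.1 fun S hS => by linarith [h S hS]
    exact ⟨z, W, hW, by linarith, hpsd⟩
  · rintro ⟨z, W, hW, hle, hpsd⟩ S hS
    linarith [key.2 ⟨z, W, hW, by linarith, hpsd⟩ S hS]
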